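/- **Setting.** Fix a first order language with a constant symbol $0$ and a unary function symbol $s$ (and possibly other function and predicate symbols). Types are the second order formulas built from $\bot$ and from predicate symbols and predicate variables applied to terms, using $\rightarrow$, $\forall x$ (first order variables) and $\forall X$ (predicate variables); $\neg A$ stands for $A\rightarrow\bot$. For every arity there are two kinds of predicate variables, ordinary ones $X$ and *classical variables* $X_C$. A type is *classical* if it ends with $\bot$ or with a classical variable, where an atomic formula ends with its head symbol, $A\rightarrow B$ ends as $B$ does, and $\forall v A$ ends as $A$ does. Let $E$ be a set of equations between terms, and write $a\approx b$ if $a=b$ is a consequence of (the universal closures of the equations of) $E$. Assume that $E$ is adequate with the type of integers: $s(a)\not\approx 0$ for every term $a$, and $s(a)\approx s(b)$ implies $a\approx b$. $\Lambda C$ is the set of $\lambda$-terms with an additional constant $C$ (up to renaming of bound variables); $(t)u_1\dots u_k$ denotes iterated application. The system $M2$ (with respect to $E$) has the rules: $\Gamma\vdash C:\forall X_C(\neg\neg X_C\rightarrow X_C)$ ($X_C$ of arity $0$); $\Gamma\vdash x:A$ if $x:A$ is in $\Gamma$; the usual introduction and elimination rules for $\rightarrow$ (typing $\lambda x\,t$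 and $(t)u$); the introduction of $\forall x$, $\forall X$ and $\forall X_C$ when the variable is not free in $\Gamma$; from $\Gamma\vdash t:\forall x A$ infer $\Gamma\vdash t:A[u/x]$ for every term $u$; from $\Gamma\vdash t:\forall X A$ infer $\Gamma\vdash t:A[G/X]$ for every formula $G$; from $\Gamma\vdash t:\forall X_C A$ infer $\Gamma\vdash t:A[G/X_C]$ for every classical type $G$; and from $\Gamma\vdash t:A[u/x]$ and $u\approx v$ infer $\Gamma\vdash t:A[v/x]$. The quantifier rules do not change the term $t$. Let $N[x]=\forall X\{X(0),\forall y(X(y)\rightarrow X(s(y)))\rightarrow X(x)\}$, where $A,B\rightarrow D$ means $A\rightarrow(B\rightarrow D)$, and let $N^C[x]=\forall X_C\{X_C(0),\forall y(X_C(y)\rightarrow X_C(s(y)))\rightarrow X_C(x)\}$ be its classical translation. A *classical integer of value $n$* is a closed $\lambda C$-term $\theta_n$ such that $\vdash_{M2}\theta_n:N^C[s^n(0)]$. Let $P$ be an infinite set of *stack constants*, and let $\Lambda CP$ be the set of $\lambda C$-terms in which stack constants may occur, in argument position only: $\Lambda CP$ contains the variables and $C$, is closed under $\lambda$-abstraction,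 and contains $(t)u$ whenever $t\in\Lambda CP$ and $u\in\Lambda CP\cup P$. On $\Lambda CP$, $t\triangleright_C t'$ means that $t'$ is obtained from $t$ by finitely many (possibly zero) steps of the form $$(\lambda x\,u)\,t\,t_1\dots t_k\rightarrow(u[t/x])\,t_1\dots t_k,\qquad (C)\,t\,t_1\dots t_k\rightarrow(t)\,\lambda x(x)t_1\dots t_k,$$ where $u,t\in\Lambda CP$, $t_1,\dots,t_k\in\Lambda CP\cup P$ and, in the second rule, $x$ does not occur in $t_1,\dots,t_k$. **Theorem 5.6.** Let $n\ge 0$ be an integer, $\theta_n$ a classical integer of value $n$, and $x,g$ two distinct variables. * If $n=0$, then for every stack constant $p$ we have $(\theta_n)xgp\triangleright_C(x)p$. * If $n\neq 0$, then there are $m\ge 1$, a mapping $I:\{0,\dots,m\}\to\mathbb N$ and indices $r_0,\dots,r_m\in\{0,\dots,m\}$ with $$I(0)=n,\qquad I(r_m)=0,\qquad I(i+1)=I(r_i)-1\quad(0\le i\le m-1),$$ such that for all distinct stack constants $p_0,p_1,\dots,p_m$ there are terms $t_1,\dots,t_m\in\Lambda CP$ with $$(\theta_n)xgp_0\triangleright_C(g)t_1p_{r_0};$$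 $$(t_i)p_i\triangleright_C(g)t_{i+1}p_{r_i}\quad(1\le i\le m-1);$$ $$(t_m)p_m\triangleright_C(x)p_{r_m}.$$ -/

import Mathlib

universe u v w

namespace MixedLogic

/-! Types: formulas of second order predicate logic over a language `L`, with two kinds of
predicate variables of every arity, ordinary and classical. Bound variables are de Bruijn
indices: first order variables form one family of indices, and predicate variables form one
family of indices for every kind and every arity. -/

/-- The two kinds of predicate variables: `X` (ordinary) and `X_C` (classical). -/
inductive Kind : Type
  | ord : Kind
  | cls : Kind
  deriving DecidableEq

/-- Formulas (types). -/
inductive Formula (L : FirstOrder.Language.{u, v}) : Type (max u v)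
  | bot : Formula L
  /-- a predicate symbol applied to terms -/
  | rel {n : ℕ} (R : L.Relations n) (ts : Fin n → L.Term ℕ) : Formula L
  /-- the predicate variable of kind `κ`, arity `n` and index `k`, applied to terms -/
  | pvar (κ : Kind) (n k : ℕ) (ts : Fin n → L.Term ℕ) : Formula L
  | imp (A B : Formula L) : Formula L
  /-- first order quantification -/
  | all1 (A : Formula L) : Formula L
  /-- quantification over the predicate variables of kind `κ` and arity `n` -/
  | all2 (κ : Kind) (n : ℕ) (A : Formula L) : Formula L

namespace Formula

variable {L : FirstOrder.Language.{u, v}}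

/-- `¬A` is `A → ⊥`. -/
def neg (A : Formula L) : Formula L := imp A bot

/-- Classical types: those which end with `⊥` or with a classical variable. -/
def IsClassical : Formula L → Prop
  | bot => True
  | rel _ _ => False
  | pvar κ _ _ _ => κ = Kind.cls
  | imp _ B => IsClassical B
  | all1 A => IsClassical A
  | all2 _ _ A => IsClassical A

/-- A first order substitution pushed under a first order binder. -/
def up1 (σ : ℕ → L.Term ℕ) : ℕ → L.Term ℕ
  | 0 => FirstOrder.Language.Term.var 0
  | k + 1 => (σ k).relabel Nat.succ

/-- Simultaneous substitution of terms for the first order variables. -/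
def subst1 : (ℕ → L.Term ℕ) → Formula L → Formula L
  | _, bot => bot
  | σ, rel R ts => rel R (fun i => (ts i).subst σ)
  | σ, pvar κ n k ts => pvar κ n k (fun i => (ts i).subst σ)
  | σ, imp A B => imp (subst1 σ A) (subst1 σ B)
  | σ, all1 A => all1 (subst1 (up1 σ) A)
  | σ, all2 κ n A => all2 κ n (subst1 σ A)

/-- Weakening by a new first order variable, of index `0`. -/
def shift1 (A : Formula L) : Formula L :=
  subst1 (fun k => FirstOrder.Language.Term.var (k + 1)) A

/-- `A[t/x]`, where `x` is the first order variable of index `0`. -/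
def inst1 (A : Formula L) (t : L.Term ℕ) : Formula L :=
  subst1 (fun k => Nat.casesOn k t FirstOrder.Language.Term.var) A

/-- A renaming of predicate variables pushed under a binder of kind `κ` and arity `n`. -/
def upRen2 (κ : Kind) (n : ℕ) (ρ : Kind → ℕ → ℕ → ℕ) : Kind → ℕ → ℕ → ℕ :=
  fun κ' n' k =>
    if κ' = κ ∧ n' = n then Nat.casesOn k 0 (fun j => ρ κ' n' j + 1) else ρ κ' n' k

/-- Renaming of predicate variables, respecting kinds and arities. -/
def ren2 : (Kind → ℕ → ℕ → ℕ) → Formula L → Formula L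
  | _, bot => bot
  | _, rel R ts => rel R ts
  | ρ, pvar κ n k ts => pvar κ n (ρ κ n k) ts
  | ρ, imp A B => imp (ren2 ρ A) (ren2 ρ B)
  | ρ, all1 A => all1 (ren2 ρ A)
  | ρ, all2 κ n A => all2 κ n (ren2 (upRen2 κ n ρ) A)

/-- Weakening by a new predicate variable of kind `κ` and arity `n`, of index `0`. -/
def shift2 (κ : Kind) (n : ℕ) (A : Formula L) : Formula L :=
  ren2 (fun κ' n' k => if κ' = κ ∧ n' = n then k + 1 else k) A

/-! A formula `G` put in the place of an `n`-ary predicate variable has parameters `x₁, …, xₙ`: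
these are its first order variables of index `0, …, n - 1`, and its index `n + j` stands for the
ambient first order variable of index `j`. -/

/-- The first order substitution which gives the `n` parameters the values `ts`. -/
def params {n : ℕ} (ts : Fin n → L.Term ℕ) : ℕ → L.Term ℕ :=
  fun j => if h : j < n then ts ⟨j, h⟩ else FirstOrder.Language.Term.var (j - n)

/-- The atomic formula `X(x₁, …, xₙ)` over the `n` parameters. -/
def atom (κ : Kind) (n k : ℕ) : Formula L :=
  pvar κ n k (fun i => FirstOrder.Language.Term.var (i : ℕ))

/-- A predicate substitution pushed under a first order binder: the ambient first order
variables are shifted, the parameters are not. -/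
def up2all1 (τ : Kind → ℕ → ℕ → Formula L) : Kind → ℕ → ℕ → Formula L :=
  fun κ n k =>
    subst1 (fun j => if j < n then FirstOrder.Language.Term.var j else FirstOrder.Language.Term.var (j + 1)) (τ κ n k)

/-- A predicate substitution pushed under a binder of kind `κ` and arity `n`. -/
def up2all2 (κ : Kind) (n : ℕ) (τ : Kind → ℕ → ℕ → Formula L) : Kind → ℕ → ℕ → Formula L :=
  fun κ' n' k =>
    if κ' = κ ∧ n' = n then
      Nat.casesOn k (atom κ' n' 0) (fun j => shift2 κ n (τ κ' n' j))
    else shift2 κ n (τ κ' n' k)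

/-- Simultaneous substitution of formulas with parameters for the predicate variables:
`X(t₁, …, tₙ)` becomes `G[t₁/x₁, …, tₙ/xₙ]`. -/
def subst2 : (Kind → ℕ → ℕ → Formula L) → Formula L → Formula L
  | _, bot => bot
  | _, rel R ts => rel R ts
  | τ, pvar κ n k ts => subst1 (params ts) (τ κ n k)
  | τ, imp A B => imp (subst2 τ A) (subst2 τ B)
  | τ, all1 A => all1 (subst2 (up2all1 τ) A)
  | τ, all2 κ n A => all2 κ n (subst2 (up2all2 κ n τ) A)

/-- `A[G/X]`, where `X` is the predicate variable of kind `κ`, arity `n` and index `0`. -/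
def inst2 (A : Formula L) (κ : Kind) (n : ℕ) (G : Formula L) : Formula L :=
  subst2 (fun κ' n' k =>
    if κ' = κ ∧ n' = n then Nat.casesOn k G (fun j => atom κ' n' j) else atom κ' n' k) A

/-- The classical translation `A ↦ A^C`, for formulas `A` without classical variables: every
predicate variable becomes a classical variable of the same arity. -/
def classical : Formula L → Formula L
  | bot => bot
  | rel R ts => rel R ts
  | pvar _ n k ts => pvar Kind.cls n k ts
  | imp A B => imp (classical A) (classical B)
  | all1 A => all1 (classical A)
  | all2 _ n A => all2 Kind.cls n (classical A)

end Formula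

section Integers

variable {L : FirstOrder.Language.{u, v}}

/-- The term `0`. -/
def zeroT (zero : L.Functions 0) : L.Term ℕ := FirstOrder.Language.Term.func zero Fin.elim0

/-- The term `s(t)`. -/
def succT (succ : L.Functions 1) (t : L.Term ℕ) : L.Term ℕ := FirstOrder.Language.Term.func succ (fun _ => t)

/-- The term `sⁿ(0)`. -/
def numeral (zero : L.Functions 0) (succ : L.Functions 1) : ℕ → L.Term ℕ
  | 0 => zeroT zero
  | n + 1 => succT succ (numeral zero succ n)

/-- `N[t] = ∀X (X(0) → ∀y (X(y) → X(s(y))) → X(t))`. -/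
def natType (zero : L.Functions 0) (succ : L.Functions 1) (t : L.Term ℕ) : Formula L :=
  let X : L.Term ℕ → Formula L := fun a => Formula.pvar Kind.ord 1 0 (fun _ => a)
  let y : L.Term ℕ := FirstOrder.Language.Term.var 0
  Formula.all2 Kind.ord 1
    (Formula.imp (X (zeroT zero))
      (Formula.imp (Formula.all1 (Formula.imp (X y) (X (succT succ y)))) (X t)))

/-- `u ≈ v`: the equation `u = v` is a consequence of the (universally closed) equations `E`,
that is, it is derivable from `E` in equational logic. -/
inductive EqCons (E : Set (L.Term ℕ × L.Term ℕ)) : L.Term ℕ → L.Term ℕ → Prop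
  | ax {a b : L.Term ℕ} (h : (a, b) ∈ E) (σ : ℕ → L.Term ℕ) : EqCons E (a.subst σ) (b.subst σ)
  | refl (a : L.Term ℕ) : EqCons E a a
  | symm {a b : L.Term ℕ} (h : EqCons E a b) : EqCons E b a
  | trans {a b c : L.Term ℕ} (h : EqCons E a b) (h' : EqCons E b c) : EqCons E a c
  | congr {n : ℕ} (f : L.Functions n) {as bs : Fin n → L.Term ℕ}
      (h : ∀ i, EqCons E (as i) (bs i)) :
      EqCons E (FirstOrder.Language.Term.func f as) (FirstOrder.Language.Term.func f bs)

/-- A set of equations adequate with the type of integers. -/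
def Adequate (zero : L.Functions 0) (succ : L.Functions 1) (E : Set (L.Term ℕ × L.Term ℕ)) :
    Prop :=
  (∀ a, ¬ EqCons E (succT succ a) (zeroT zero)) ∧
    ∀ a b, EqCons E (succT succ a) (succT succ b) → EqCons E a b

end Integers

/-! `λC`-terms, up to renaming of bound variables: de Bruijn indices, where the indices which are
not bound are the free variables. -/

/-- The set `ΛC` of `λC`-terms. -/
inductive LamC : Type
  | var (x : ℕ) : LamC
  | ctl : LamC
  | lam (t : LamC) : LamC
  | app (t s : LamC) : LamC

/-- All free indices are smaller than `k`. -/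
def LamC.FreeBelow : ℕ → LamC → Prop
  | k, .var x => x < k
  | _, .ctl => True
  | k, .lam t => FreeBelow (k + 1) t
  | k, .app t s => FreeBelow k t ∧ FreeBelow k s

/-- Closed `λC`-terms. -/
def LamC.Closed (t : LamC) : Prop := t.FreeBelow 0

section Typing

variable {L : FirstOrder.Language.{u, v}}

open Formula

/-- The judgement `Γ ⊢_{M2} t : A` with respect to the set of equations `E`. The context `Γ` lists
the types of the variables of index `0, 1, …`. A variable which is not free in the context is
a new variable, for which the context is weakened. -/
inductive M2 (E : Set (L.Term ℕ × L.Term ℕ)) : List (Formula L) → LamC → Formula L → Prop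
  /-- `C : ∀X_C (¬¬X_C → X_C)` -/
  | ctl (Γ : List (Formula L)) :
      M2 E Γ LamC.ctl
        (all2 Kind.cls 0 (imp (neg (neg (pvar Kind.cls 0 0 Fin.elim0)))
          (pvar Kind.cls 0 0 Fin.elim0)))
  | var {Γ : List (Formula L)} {x : ℕ} {A : Formula L} (h : Γ[x]? = some A) :
      M2 E Γ (LamC.var x) A
  | lam {Γ : List (Formula L)} {t : LamC} {A B : Formula L} (h : M2 E (A :: Γ) t B) :
      M2 E Γ (LamC.lam t) (imp A B)
  | app {Γ : List (Formula L)} {t s : LamC} {A B : Formula L}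
      (h : M2 E Γ t (imp A B)) (h' : M2 E Γ s A) : M2 E Γ (LamC.app t s) B
  | gen1 {Γ : List (Formula L)} {t : LamC} {A : Formula L} (h : M2 E (Γ.map shift1) t A) :
      M2 E Γ t (all1 A)
  | inst1 {Γ : List (Formula L)} {t : LamC} {A : Formula L} (a : L.Term ℕ)
      (h : M2 E Γ t (all1 A)) : M2 E Γ t (A.inst1 a)
  /-- generalization over an ordinary predicate variable -/
  | gen2 {Γ : List (Formula L)} {t : LamC} {n : ℕ} {A : Formula L}
      (h : M2 E (Γ.map (shift2 Kind.ord n)) t A) : M2 E Γ t (all2 Kind.ord n A)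
  /-- an ordinary predicate variable may be replaced by any formula -/
  | inst2 {Γ : List (Formula L)} {t : LamC} {n : ℕ} {A : Formula L} (G : Formula L)
      (h : M2 E Γ t (all2 Kind.ord n A)) : M2 E Γ t (A.inst2 Kind.ord n G)
  /-- generalization over a classical variable -/
  | genC {Γ : List (Formula L)} {t : LamC} {n : ℕ} {A : Formula L}
      (h : M2 E (Γ.map (shift2 Kind.cls n)) t A) : M2 E Γ t (all2 Kind.cls n A)
  /-- a classical variable may be replaced by any classical type -/
  | instC {Γ : List (Formula L)} {t : LamC} {n : ℕ} {A : Formula L} (G : Formula L)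
      (hG : G.IsClassical) (h : M2 E Γ t (all2 Kind.cls n A)) :
      M2 E Γ t (A.inst2 Kind.cls n G)
  | eqn {Γ : List (Formula L)} {t : LamC} {A : Formula L} {a b : L.Term ℕ}
      (h : M2 E Γ t (A.inst1 a)) (hab : EqCons E a b) : M2 E Γ t (A.inst1 b)

/-- Classical integers of value `n`: closed `λC`-terms `θ` with `⊢_{M2} θ : N^C[sⁿ(0)]`. -/
def IsClassicalInteger (zero : L.Functions 0) (succ : L.Functions 1)
    (E : Set (L.Term ℕ × L.Term ℕ)) (n : ℕ) (θ : LamC) : Prop :=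
  θ.Closed ∧ M2 E [] θ (natType zero succ (numeral zero succ n)).classical

end Typing

/-- The set `ΛCP` of `λC`-terms with stack constants from `P` in argument positions only: `app`
applies a term to a term, and `appS` applies a term to a stack constant. -/
inductive LamCP (P : Type w) : Type w
  | var (x : ℕ) : LamCP P
  | ctl : LamCP P
  | lam (t : LamCP P) : LamCP P
  | app (t s : LamCP P) : LamCP P
  | appS (t : LamCP P) (p : P) : LamCP P

/-- The inclusion of `ΛC` in `ΛCP`. -/
def LamC.toCP {P : Type w} : LamC → LamCP P
  | .var x => .var x
  | .ctl => .ctl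
  | .lam t => .lam t.toCP
  | .app t s => .app t.toCP s.toCP

namespace LamCP

variable {P : Type w}

/-- A renaming pushed under `λ`. -/
def upRen (ρ : ℕ → ℕ) : ℕ → ℕ
  | 0 => 0
  | k + 1 => ρ k + 1

/-- Renaming of free variables. -/
def rename : (ℕ → ℕ) → LamCP P → LamCP P
  | ρ, var x => var (ρ x)
  | _, ctl => ctl
  | ρ, lam t => lam (rename (upRen ρ) t)
  | ρ, app t s => app (rename ρ t) (rename ρ s)
  | ρ, appS t p => appS (rename ρ t) p

/-- Weakening by a new variable, of index `0`. -/
def shift (t : LamCP P) : LamCP P := rename Nat.succ t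

/-- A substitution pushed under `λ`. -/
def up (σ : ℕ → LamCP P) : ℕ → LamCP P
  | 0 => var 0
  | k + 1 => shift (σ k)

/-- Simultaneous substitution for the free variables. -/
def subst : (ℕ → LamCP P) → LamCP P → LamCP P
  | σ, var x => σ x
  | _, ctl => ctl
  | σ, lam t => lam (subst (up σ) t)
  | σ, app t s => app (subst σ t) (subst σ s)
  | σ, appS t p => appS (subst σ t) p

/-- `u[t/x]`, where `x` is the variable of index `0`. -/
def inst (u t : LamCP P) : LamCP P :=
  subst (fun k => Nat.casesOn k t var) u

/-- Application to an argument from `ΛCP ∪ P`. -/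
def appArg : LamCP P → LamCP P ⊕ P → LamCP P
  | t, Sum.inl s => app t s
  | t, Sum.inr p => appS t p

/-- `(t)t₁…tₙ` with `t₁, …, tₙ ∈ ΛCP ∪ P`. -/
def apps (t : LamCP P) (l : List (LamCP P ⊕ P)) : LamCP P := l.foldl appArg t

/-- One step of head reduction on `ΛCP`. -/
inductive Step : LamCP P → LamCP P → Prop
  /-- `(λx u) t t₁…tₙ → (u[t/x]) t₁…tₙ` -/
  | beta (u t : LamCP P) (l : List (LamCP P ⊕ P)) :
      Step (apps (app (lam u) t) l) (apps (inst u t) l)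
  /-- `(C) t t₁…tₙ → (t) λx (x)t₁…tₙ`, with `x` not appearing in `t₁, …, tₙ` -/
  | ctl (t : LamCP P) (l : List (LamCP P ⊕ P)) :
      Step (apps (app ctl t) l) (app t (lam (apps (var 0) (l.map (Sum.map shift id)))))

/-- `t ▷_C t'`: finitely many steps, possibly none. -/
def Red (t t' : LamCP P) : Prop := Relation.ReflTransGen Step t t'

end LamCP

end MixedLogic

/-! The proof is a realizability argument with stacks. Formulas denote sets of stacks, and a term
realizes a formula if, applied to each such stack, it gives a process in a fixed pole. Terms modulo
provable equality form the first order domain, and predicate variables of both kinds range over all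
set-of-stacks-valued functions. If the pole is closed under head expansion, typed terms realize
their types (`M2.realizes`); `C` does so because it hands over a term that restores the current
stack.

The pole is chosen for integers. Stack constants are pairs (value, name), and `IntPole` contains the
processes which, after finitely many calls of `g`, end with `x` on a constant of value `0`. A call
of `g` on a constant of value `k + 1` must be safe under every answer of value `k`. With `X(d)` read
as the one-constant stacks whose value denotes `d`, adequacy of `E` makes `x` and `g` realize the
premises of `N^C`, so `(θ)xgp` lies in the pole (`IsClassicalInteger.intPole`).

Since the pole is inductive, answering each call with a fresh constant yields a finite run
(`IntPole.exists_run`). Reduction creates no constants, so each constant met by the run has already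
been allocated; this gives the indices `r`, and the values give `I`. Finally, reduction does not
inspect constants, so a single run with distinct constants can be renamed to any prescribed ones
(`Red.mapConst`). Hence `m`, `I` and `r` do not depend on the `p i`. -/

namespace MixedLogic

namespace LamCP

/-! ### Substitution calculus for de Bruijn terms. -/

section Substitution

variable {P : Type w}

theorem upRen_comp (ρ ρ' : ℕ → ℕ) : upRen ρ' ∘ upRen ρ = upRen (ρ' ∘ ρ) := by
  funext k; cases k <;> rfl

theorem rename_rename (t : LamCP P) (ρ ρ' : ℕ → ℕ) :
    rename ρ' (rename ρ t) = rename (ρ' ∘ ρ) t := by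
  induction t generalizing ρ ρ' <;> simp_all [rename, upRen_comp]

theorem up_comp_upRen (ρ : ℕ → ℕ) (σ : ℕ → LamCP P) : up σ ∘ upRen ρ = up (σ ∘ ρ) := by
  funext k; cases k <;> rfl

theorem subst_rename (t : LamCP P) (ρ : ℕ → ℕ) (σ : ℕ → LamCP P) :
    subst σ (rename ρ t) = subst (σ ∘ ρ) t := by
  induction t generalizing ρ σ <;> simp_all [rename, subst, up_comp_upRen]

theorem rename_upRen_up (ρ : ℕ → ℕ) (σ : ℕ → LamCP P) :
    (fun k => rename (upRen ρ) (up σ k)) = up (fun k => rename ρ (σ k)) := by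
  funext k
  cases k with
  | zero => rfl
  | succ k => simp only [up, shift, rename_rename]; rfl

theorem rename_subst (t : LamCP P) (ρ : ℕ → ℕ) (σ : ℕ → LamCP P) :
    rename ρ (subst σ t) = subst (fun k => rename ρ (σ k)) t := by
  induction t generalizing ρ σ <;> simp_all [rename, subst, rename_upRen_up]

theorem subst_up_up (σ σ' : ℕ → LamCP P) :
    (fun k => subst (up σ') (up σ k)) = up (fun k => subst σ' (σ k)) := by
  funext k
  cases k with
  | zero => rfl
  | succ k => simp only [up, shift, subst_rename, rename_subst]; rfl

theorem subst_subst (t : LamCP P) (σ σ' : ℕ → LamCP P) :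
    subst σ' (subst σ t) = subst (fun k => subst σ' (σ k)) t := by
  induction t generalizing σ σ' <;> simp_all [subst, subst_up_up]

theorem up_var : up (var : ℕ → LamCP P) = var := by
  funext k; cases k <;> rfl

theorem subst_var (t : LamCP P) : subst var t = t := by
  induction t <;> simp_all [subst, up_var]

theorem inst_shift (t s : LamCP P) : inst (shift t) s = t := by
  rw [inst, shift, subst_rename]
  exact subst_var t

/-- The substitution which maps the index `0` to `a` and is `σ` on the other indices. -/
def consSubst (a : LamCP P) (σ : ℕ → LamCP P) : ℕ → LamCP P
  | 0 => a
  | k + 1 => σ k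

/-- Turns the result of a β-step on a substituted abstraction into a single substitution, as the
`lam` case of `M2.realizes` needs. -/
theorem inst_subst_up (t a : LamCP P) (σ : ℕ → LamCP P) :
    inst (subst (up σ) t) a = subst (consSubst a σ) t := by
  rw [inst, subst_subst]
  congr 1
  funext k
  cases k with
  | zero => rfl
  | succ k => exact inst_shift (σ k) a

/-- With `t = var 0` this is the β-step of the continuation `λx (x)t₁…tₙ` created by `C`: it
restores the saved stack. -/
theorem inst_apps (t a : LamCP P) (l : List (LamCP P ⊕ P)) :
    inst (apps t (l.map (Sum.map shift id))) a = apps (inst t a) l := by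
  induction l generalizing t with
  | nil => rfl
  | cons b l ih =>
    cases b with
    | inl b =>
      refine (ih (app t (shift b))).trans ?_
      change apps (app (inst t a) (inst (shift b) a)) l = _
      rw [inst_shift]; rfl
    | inr b => exact ih (appS t b)

end Substitution

/-! ### Stack constants occurring in a term. -/

section Constants

variable {P : Type w}

/-- All stack constants of a term belong to `S`. -/
def ConstsIn (S : Set P) : LamCP P → Prop
  | var _ => True
  | ctl => True
  | lam t => ConstsIn S t
  | app t s => ConstsIn S t ∧ ConstsIn S s
  | appS t p => ConstsIn S t ∧ p ∈ S

/-- All stack constants of an argument belong to `S`. -/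
def ArgConstsIn (S : Set P) : LamCP P ⊕ P → Prop
  | Sum.inl t => ConstsIn S t
  | Sum.inr p => p ∈ S

variable {S : Set P}

theorem ConstsIn.mono {S' : Set P} (hS : S ⊆ S') {t : LamCP P} (ht : ConstsIn S t) :
    ConstsIn S' t := by
  induction t with
  | var | ctl => trivial
  | lam t ih => exact ih ht
  | app t s iht ihs => exact ⟨iht ht.1, ihs ht.2⟩
  | appS t p ih => exact ⟨ih ht.1, hS ht.2⟩

theorem constsIn_toCP (t : LamC) : ConstsIn S (t.toCP : LamCP P) := by
  induction t <;> simp_all [LamC.toCP, ConstsIn]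

theorem constsIn_rename (ρ : ℕ → ℕ) (t : LamCP P) :
    ConstsIn S (rename ρ t) ↔ ConstsIn S t := by
  induction t generalizing ρ <;> simp_all [rename, ConstsIn]

theorem ConstsIn.subst {t : LamCP P} (ht : ConstsIn S t) {σ : ℕ → LamCP P}
    (hσ : ∀ k, ConstsIn S (σ k)) : ConstsIn S (LamCP.subst σ t) := by
  induction t generalizing σ with
  | var x => exact hσ x
  | ctl => trivial
  | lam t ih =>
    refine ih ht fun k => ?_
    cases k with
    | zero => trivial
    | succ k => exact (constsIn_rename _ _).2 (hσ k)
  | app t s iht ihs => exact ⟨iht ht.1 hσ, ihs ht.2 hσ⟩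
  | appS t p ih => exact ⟨ih ht.1 hσ, ht.2⟩

theorem ConstsIn.inst {u t : LamCP P} (hu : ConstsIn S u) (ht : ConstsIn S t) :
    ConstsIn S (LamCP.inst u t) :=
  hu.subst fun k => by cases k <;> trivial

theorem constsIn_apps (t : LamCP P) (l : List (LamCP P ⊕ P)) :
    ConstsIn S (apps t l) ↔ ConstsIn S t ∧ ∀ a ∈ l, ArgConstsIn S a := by
  induction l generalizing t with
  | nil => simp [apps]
  | cons b l ih =>
    have h := ih (appArg t b)
    cases b <;>
      simpa [apps, appArg, ConstsIn, ArgConstsIn, and_assoc] using h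

/-- Head reduction moves, copies or erases constants but never invents one; this is the source of
the bound `r j ≤ j` in a run. -/
theorem ConstsIn.step {t t' : LamCP P} (ht : ConstsIn S t) (h : Step t t') : ConstsIn S t' := by
  cases h with
  | beta u t l =>
    rw [constsIn_apps] at ht ⊢
    exact ⟨ConstsIn.inst ht.1.1 ht.1.2, ht.2⟩
  | ctl t l =>
    rw [constsIn_apps] at ht
    refine ⟨ht.1.2, (constsIn_apps _ _).2 ⟨trivial, ?_⟩⟩
    intro a ha
    obtain ⟨b, hb, rfl⟩ := List.mem_map.1 ha
    have := ht.2 b hb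
    cases b with
    | inl b => exact (constsIn_rename _ _).2 this
    | inr b => exact this

end Constants

/-! ### Renaming of stack constants. -/

section Map

variable {P : Type*} {Q : Type*} (f : P → Q)

/-- Replacement of stack constants. -/
def mapConst : LamCP P → LamCP Q
  | var x => var x
  | ctl => ctl
  | lam t => lam (mapConst t)
  | app t s => app (mapConst t) (mapConst s)
  | appS t p => appS (mapConst t) (f p)

theorem mapConst_toCP (t : LamC) : mapConst f (t.toCP : LamCP P) = t.toCP := by
  induction t <;> simp_all [LamC.toCP, mapConst]

theorem mapConst_rename (ρ : ℕ → ℕ) (t : LamCP P) :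
    mapConst f (rename ρ t) = rename ρ (mapConst f t) := by
  induction t generalizing ρ <;> simp_all [rename, mapConst]

theorem mapConst_up (σ : ℕ → LamCP P) :
    (fun k => mapConst f (up σ k)) = up (fun k => mapConst f (σ k)) := by
  funext k
  cases k with
  | zero => rfl
  | succ k => exact mapConst_rename f _ _

theorem mapConst_subst (σ : ℕ → LamCP P) (t : LamCP P) :
    mapConst f (subst σ t) = subst (fun k => mapConst f (σ k)) (mapConst f t) := by
  induction t generalizing σ <;> simp_all [subst, mapConst, mapConst_up]

theorem mapConst_inst (u t : LamCP P) :
    mapConst f (inst u t) = inst (mapConst f u) (mapConst f t) := by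
  rw [inst, inst, mapConst_subst]
  congr 1
  funext k
  cases k <;> rfl

theorem mapConst_apps (t : LamCP P) (l : List (LamCP P ⊕ P)) :
    mapConst f (apps t l) = apps (mapConst f t) (l.map (Sum.map (mapConst f) f)) := by
  induction l generalizing t with
  | nil => rfl
  | cons b l ih => cases b <;> exact ih _

/-- Neither rule looks at which constants occur, so `f` need not be injective. -/
theorem Step.mapConst {t t' : LamCP P} (h : Step t t') :
    Step (LamCP.mapConst f t) (LamCP.mapConst f t') := by
  cases h with
  | beta u t l =>
    rw [mapConst_apps, mapConst_apps, mapConst_inst]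
    exact Step.beta _ _ _
  | ctl t l =>
    rw [mapConst_apps]
    have hl : (l.map (Sum.map shift id)).map (Sum.map (LamCP.mapConst f) f) =
        (l.map (Sum.map (LamCP.mapConst f) f)).map (Sum.map shift id) := by
      rw [List.map_map, List.map_map]
      refine List.map_congr_left fun b _ => ?_
      cases b with
      | inl b => exact congrArg Sum.inl (mapConst_rename f _ _)
      | inr b => rfl
    change Step _ (app _ (lam (LamCP.mapConst f (apps (var 0) _))))
    rw [mapConst_apps, hl]
    exact Step.ctl _ _

theorem Red.mapConst {t t' : LamCP P} (h : Red t t') :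
    Red (LamCP.mapConst f t) (LamCP.mapConst f t') :=
  Relation.ReflTransGen.lift (LamCP.mapConst f) (fun _ _ => Step.mapConst f) _ _ h

end Map

end LamCP

/-! ### The model of terms modulo provable equality. -/

section TermModel

open FirstOrder.Language

variable {L : FirstOrder.Language.{u, v}} (E : Set (L.Term ℕ × L.Term ℕ))

theorem EqCons.subst {E : Set (L.Term ℕ × L.Term ℕ)} {a b : L.Term ℕ} (h : EqCons E a b)
    (σ : ℕ → L.Term ℕ) : EqCons E (a.subst σ) (b.subst σ) := by
  induction h with
  | @ax a b h τ =>
    have hs : ∀ c : L.Term ℕ, (c.subst τ).subst σ = c.subst fun k => (τ k).subst σ := by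
      intro c
      induction c with
      | var => rfl
      | func f ts ih => simp [Term.subst, ih]
    rw [hs, hs]
    exact EqCons.ax h _
  | refl => exact EqCons.refl _
  | symm _ ih => exact ih.symm
  | trans _ _ ih ih' => exact ih.trans ih'
  | congr f _ ih => exact EqCons.congr f ih

/-- Provable equality, as an equivalence relation on terms. -/
def eqSetoid : Setoid (L.Term ℕ) where
  r := EqCons E
  iseqv := ⟨EqCons.refl, EqCons.symm, EqCons.trans⟩

/-- Terms modulo provable equality. -/
def TermModel : Type u := Quotient (eqSetoid E)

/-- The class of a term. -/
def TermModel.mk (a : L.Term ℕ) : TermModel E := Quotient.mk (eqSetoid E) a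

variable {E}

/-- A representative of a class of terms. -/
noncomputable def TermModel.rep (d : TermModel E) : L.Term ℕ := Quotient.out d

theorem TermModel.mk_rep (d : TermModel E) : mk E d.rep = d := Quotient.out_eq d

theorem TermModel.mk_eq_mk {a b : L.Term ℕ} : mk E a = mk E b ↔ EqCons E a b :=
  ⟨fun h => Quotient.exact h, fun h => Quotient.sound (s := eqSetoid E) h⟩

/-- Congruence makes the choice of representatives harmless. The value of `RelMap` is immaterial,
since `falsity` interprets predicate symbols without consulting it. -/
noncomputable instance : L.Structure (TermModel E) where
  funMap f ds := TermModel.mk E (Term.func f fun i => (ds i).rep)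
  RelMap _ _ := False

theorem TermModel.realize_eq (a : L.Term ℕ) (ρ : ℕ → TermModel E) :
    a.realize ρ = mk E (a.subst fun k => (ρ k).rep) := by
  induction a with
  | var k => exact (mk_rep (ρ k)).symm
  | func f ts ih =>
    refine mk_eq_mk.2 (EqCons.congr f fun i => ?_)
    rw [← mk_eq_mk, mk_rep]
    exact ih i

theorem EqCons.realize_eq {a b : L.Term ℕ} (h : EqCons E a b) (ρ : ℕ → TermModel E) :
    a.realize ρ = b.realize ρ := by
  rw [TermModel.realize_eq, TermModel.realize_eq, TermModel.mk_eq_mk]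
  exact h.subst _

theorem numeral_subst (zero : L.Functions 0) (succ : L.Functions 1) (n : ℕ) (σ : ℕ → L.Term ℕ) :
    (numeral zero succ n).subst σ = numeral zero succ n := by
  induction n with
  | zero =>
    simp only [numeral, zeroT, Term.subst]
    congr 1
    exact Subsingleton.elim _ _
  | succ n ih => simp [numeral, succT, Term.subst, ih]

theorem realize_numeral (zero : L.Functions 0) (succ : L.Functions 1) (n : ℕ)
    (ρ : ℕ → TermModel E) :
    (numeral zero succ n).realize ρ = TermModel.mk E (numeral zero succ n) := by
  rw [TermModel.realize_eq, numeral_subst]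

end TermModel

/-! ### Falsity values and soundness of typing. -/

section Realizability

open FirstOrder.Language Formula

variable {L : FirstOrder.Language.{u, v}} {M : Type*} {P : Type w}

/-- A valuation extended by a value for the index `0`. -/
def consVal (d : M) (ρ : ℕ → M) : ℕ → M
  | 0 => d
  | k + 1 => ρ k

/-- A valuation extended by values for the first `n` indices. -/
def paramVal {n : ℕ} (ds : Fin n → M) (ρ : ℕ → M) : ℕ → M :=
  fun j => if h : j < n then ds ⟨j, h⟩ else ρ (j - n)

/-- Interpretations of the predicate variables by sets of stacks. -/
abbrev Interp (M : Type*) (P : Type w) : Type _ :=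
  Kind → (n : ℕ) → ℕ → (Fin n → M) → Set (List (LamCP P ⊕ P))

/-- An interpretation extended by a value for the variable of index `0`. -/
def Interp.cons (κ : Kind) (n : ℕ) (F : (Fin n → M) → Set (List (LamCP P ⊕ P)))
    (I : Interp M P) : Interp M P :=
  fun κ' n' k ds =>
    if h : κ' = κ ∧ n' = n then
      Nat.casesOn k (F fun i => ds (Fin.cast h.2.symm i)) (fun j => I κ' n' j ds)
    else I κ' n' k ds

variable [L.Structure M] (pole : Set (LamCP P))

/-- The falsity value of a formula: a set of stacks. -/
def falsity : (ℕ → M) → Interp M P → Formula L → Set (List (LamCP P ⊕ P))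
  | _, _, bot => {[]}
  | _, _, rel _ _ => {[]}
  | ρ, I, pvar κ n k ts => I κ n k fun i => (ts i).realize ρ
  | ρ, I, imp A B =>
      {π | ∃ a π', π = Sum.inl a :: π' ∧ (∀ π₁ ∈ falsity ρ I A, LamCP.apps a π₁ ∈ pole) ∧
        π' ∈ falsity ρ I B}
  | ρ, I, all1 A => {π | ∃ d, π ∈ falsity (consVal d ρ) I A}
  | ρ, I, all2 κ n A => {π | ∃ F, π ∈ falsity ρ (I.cons κ n F) A}

/-- `t` realizes `A` if it leads into the pole against every stack of the falsity value. -/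
def Realizes (ρ : ℕ → M) (I : Interp M P) (t : LamCP P) (A : Formula L) : Prop :=
  ∀ π ∈ falsity pole ρ I A, LamCP.apps t π ∈ pole

theorem realize_up1 (σ : ℕ → L.Term ℕ) (d : M) (ρ : ℕ → M) :
    (fun k => (up1 σ k).realize (consVal d ρ)) = consVal d fun k => (σ k).realize ρ := by
  funext k
  cases k with
  | zero => rfl
  | succ k => simp only [up1, Term.realize_relabel]; rfl

theorem falsity_subst1 (σ : ℕ → L.Term ℕ) (A : Formula L) (ρ : ℕ → M) (I : Interp M P) :
    falsity pole ρ I (subst1 σ A) = falsity pole (fun k => (σ k).realize ρ) I A := by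
  induction A generalizing σ ρ I with
  | bot | rel => rfl
  | pvar κ n k ts => simp [subst1, falsity]
  | imp A B ihA ihB => simp only [subst1, falsity, ihA, ihB]
  | all1 A ih => simp only [subst1, falsity, ih, realize_up1]
  | all2 κ n A ih => simp only [subst1, falsity, ih]

theorem falsity_inst1 (A : Formula L) (a : L.Term ℕ) (ρ : ℕ → M) (I : Interp M P) :
    falsity pole ρ I (A.inst1 a) = falsity pole (consVal (a.realize ρ) ρ) I A := by
  rw [Formula.inst1, falsity_subst1]
  congr 1
  funext k
  cases k <;> rfl

theorem falsity_shift1 (A : Formula L) (d : M) (ρ : ℕ → M) (I : Interp M P) :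
    falsity pole (consVal d ρ) I A.shift1 = falsity pole ρ I A := by
  rw [shift1, falsity_subst1]
  rfl

theorem falsity_ren2 (r : Kind → ℕ → ℕ → ℕ) (A : Formula L) (ρ : ℕ → M) (I : Interp M P) :
    falsity pole ρ I (ren2 r A) = falsity pole ρ (fun κ n k => I κ n (r κ n k)) A := by
  induction A generalizing r ρ I with
  | bot | rel | pvar => rfl
  | imp A B ihA ihB => simp only [ren2, falsity, ihA, ihB]
  | all1 A ih => simp only [ren2, falsity, ih]
  | all2 κ n A ih =>
    have h : ∀ F : (Fin n → M) → Set (List (LamCP P ⊕ P)),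
        (fun κ' n' k => I.cons κ n F κ' n' (upRen2 κ n r κ' n' k)) =
          Interp.cons κ n F fun κ n k => I κ n (r κ n k) := by
      intro F
      funext κ' n' k ds
      by_cases h : κ' = κ ∧ n' = n
      · cases k <;> simp [Interp.cons, upRen2, h]
      · simp [Interp.cons, upRen2, h]
    simp only [ren2, falsity, ih, h]

theorem falsity_shift2 (κ : Kind) (n : ℕ) (A : Formula L) (ρ : ℕ → M) (I : Interp M P)
    (F : (Fin n → M) → Set (List (LamCP P ⊕ P))) :
    falsity pole ρ (I.cons κ n F) (A.shift2 κ n) = falsity pole ρ I A := by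
  rw [shift2, falsity_ren2]
  congr 1
  funext κ' n' k ds
  by_cases h : κ' = κ ∧ n' = n <;> simp [Interp.cons, h]

theorem falsity_atom (κ : Kind) (n k : ℕ) (ds : Fin n → M) (ρ : ℕ → M) (I : Interp M P) :
    falsity pole (paramVal ds ρ) I (atom κ n k : Formula L) = I κ n k ds := by
  simp [atom, falsity, paramVal]

theorem realize_params {n : ℕ} (ts : Fin n → L.Term ℕ) (ρ : ℕ → M) :
    (fun j => (params ts j).realize ρ) = paramVal (fun i => (ts i).realize ρ) ρ := by
  funext j
  by_cases h : j < n <;> simp [params, paramVal, h]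

theorem falsity_up2all1 (τ : Kind → ℕ → ℕ → Formula L) (κ : Kind) (n k : ℕ) (ds : Fin n → M)
    (d : M) (ρ : ℕ → M) (I : Interp M P) :
    falsity pole (paramVal ds (consVal d ρ)) I (up2all1 τ κ n k) =
      falsity pole (paramVal ds ρ) I (τ κ n k) := by
  rw [up2all1, falsity_subst1]
  congr 1
  funext j
  by_cases h : j < n
  · simp [paramVal, h]
  · have h' : ¬ j + 1 < n := by omega
    simp [paramVal, h, h', show j + 1 - n = (j - n) + 1 by omega, consVal]

theorem falsity_up2all2 (κ : Kind) (n : ℕ) (τ : Kind → ℕ → ℕ → Formula L) (ρ : ℕ → M)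
    (I : Interp M P) (F : (Fin n → M) → Set (List (LamCP P ⊕ P))) :
    (fun κ' n' k ds =>
        falsity pole (paramVal ds ρ) (I.cons κ n F) (up2all2 κ n τ κ' n' k)) =
      Interp.cons κ n F fun κ' n' k ds => falsity pole (paramVal ds ρ) I (τ κ' n' k) := by
  funext κ' n' k ds
  by_cases h : κ' = κ ∧ n' = n
  · obtain ⟨rfl, rfl⟩ := h
    cases k with
    | zero => simp [up2all2, falsity_atom, Interp.cons]
    | succ k => simp [up2all2, falsity_shift2, Interp.cons]
  · simp [up2all2, h, falsity_shift2, Interp.cons]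

/-- The semantic form of comprehension: a formula with parameters defines a function from tuples to
sets of stacks, and all such functions are admitted in the `all2` clause of `falsity`. -/
theorem falsity_subst2 (τ : Kind → ℕ → ℕ → Formula L) (A : Formula L) (ρ : ℕ → M)
    (I : Interp M P) :
    falsity pole ρ I (subst2 τ A) =
      falsity pole ρ (fun κ n k ds => falsity pole (paramVal ds ρ) I (τ κ n k)) A := by
  induction A generalizing τ ρ I with
  | bot | rel => rfl
  | pvar κ n k ts => simp only [subst2, falsity, falsity_subst1, realize_params]
  | imp A B ihA ihB => simp only [subst2, falsity, ihA, ihB]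
  | all1 A ih => simp only [subst2, falsity, ih, falsity_up2all1]
  | all2 κ n A ih => simp only [subst2, falsity, ih, falsity_up2all2]

theorem falsity_inst2 (A : Formula L) (κ : Kind) (n : ℕ) (G : Formula L) (ρ : ℕ → M)
    (I : Interp M P) :
    falsity pole ρ I (A.inst2 κ n G) =
      falsity pole ρ (I.cons κ n fun ds => falsity pole (paramVal ds ρ) I G) A := by
  rw [Formula.inst2, falsity_subst2]
  congr 1
  funext κ' n' k ds
  by_cases h : κ' = κ ∧ n' = n
  · obtain ⟨rfl, rfl⟩ := h
    cases k <;> simp [Interp.cons, falsity_atom]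
  · simp [Interp.cons, h, falsity_atom]

/-- Every substitution instance of a typed term realizes its type, in every model of the
equations and for every pole closed under head expansion. -/
theorem M2.realizes {E : Set (L.Term ℕ × L.Term ℕ)}
    (hM : ∀ (a b : L.Term ℕ), EqCons E a b → ∀ ρ : ℕ → M, a.realize ρ = b.realize ρ)
    (hpole : ∀ t t', LamCP.Step t t' → t' ∈ pole → t ∈ pole)
    {Γ : List (Formula L)} {t : LamC} {A : Formula L} (h : M2 E Γ t A) (ρ : ℕ → M)
    (I : Interp M P) (σ : ℕ → LamCP P)
    (hσ : ∀ i B, Γ[i]? = some B → Realizes pole ρ I (σ i) B) :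
    Realizes pole ρ I (LamCP.subst σ t.toCP) A := by
  have shift2_ctx : ∀ {Γ : List (Formula L)} {κ : Kind} {n : ℕ} {ρ : ℕ → M} {I : Interp M P}
      {σ : ℕ → LamCP P} (F : (Fin n → M) → Set (List (LamCP P ⊕ P))),
      (∀ i B, Γ[i]? = some B → Realizes pole ρ I (σ i) B) →
      ∀ i B, (Γ.map (shift2 κ n))[i]? = some B → Realizes pole ρ (I.cons κ n F) (σ i) B := by
    intro Γ κ n ρ I σ F hσ i B hB
    obtain ⟨B', hB', rfl⟩ : ∃ B', Γ[i]? = some B' ∧ shift2 κ n B' = B := by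
      simpa using hB
    rw [Realizes, falsity_shift2]
    exact hσ i B' hB'
  induction h generalizing ρ I σ with
  | ctl Γ =>
    rintro _ ⟨F, a, π, rfl, ha, hπ⟩
    -- `⊥` has only the empty stack, so `a`, a realizer of `¬¬X`, is tested on the one-element stack
    -- holding the continuation. It remains to see that the continuation realizes `¬X`.
    refine hpole _ _ (LamCP.Step.ctl a π) (ha [Sum.inl _] ⟨_, [], rfl, ?_, rfl⟩)
    rintro _ ⟨b, _, rfl, hb, rfl⟩
    refine hpole _ _ (LamCP.Step.beta _ b []) ?_
    rw [LamCP.inst_apps]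
    exact hb π hπ
  | var h => exact hσ _ _ h
  | @lam Γ t A B _ ih =>
    rintro _ ⟨a, π, rfl, ha, hπ⟩
    refine hpole _ _ (LamCP.Step.beta _ a π) ?_
    rw [LamCP.inst_subst_up]
    refine ih ρ I _ ?_ π hπ
    intro i C hC
    cases i with
    | zero =>
      obtain rfl : A = C := by simpa using hC
      exact ha
    | succ i => exact hσ i C (by simpa using hC)
  | app _ _ ih ih' =>
    intro π hπ
    exact ih ρ I σ hσ (Sum.inl _ :: π) ⟨_, π, rfl, ih' ρ I σ hσ, hπ⟩
  | @gen1 Γ t A _ ih =>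
    rintro π ⟨d, hπ⟩
    refine ih (consVal d ρ) I σ ?_ π hπ
    intro i B hB
    obtain ⟨B', hB', rfl⟩ : ∃ B', Γ[i]? = some B' ∧ shift1 B' = B := by
      simpa using hB
    rw [Realizes, falsity_shift1]
    exact hσ i B' hB'
  | inst1 a _ ih =>
    intro π hπ
    rw [falsity_inst1] at hπ
    exact ih ρ I σ hσ π ⟨_, hπ⟩
  | gen2 _ ih | genC _ ih =>
    rintro π ⟨F, hπ⟩
    exact ih ρ _ σ (shift2_ctx F hσ) π hπ
  | inst2 G _ ih | instC G _ _ ih =>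
    intro π hπ
    rw [falsity_inst2] at hπ
    exact ih ρ I σ hσ π ⟨_, hπ⟩
  | eqn _ hab ih =>
    intro π hπ
    -- Falsity values see a first order term only through its value in the model.
    rw [falsity_inst1, ← hM _ _ hab ρ, ← falsity_inst1] at hπ
    exact ih ρ I σ hσ π hπ

end Realizability

/-! ### The pole for integers and its runs. -/

section Integers

open LamCP

/-- The processes which call `g` and `x` on stack constants of the right value finitely many
times and then halt. The first component of a stack constant is its value. -/
inductive IntPole (x g : ℕ) : LamCP (ℕ × ℕ) → Prop
  | halt (j : ℕ) : IntPole x g (appS (var x) (0, j))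
  | call (t : LamCP (ℕ × ℕ)) (k j : ℕ) (h : ∀ i, IntPole x g (appS t (k, i))) :
      IntPole x g (appS (app (var g) t) (k + 1, j))
  | step {t t' : LamCP (ℕ × ℕ)} (h : Step t t') (h' : IntPole x g t') : IntPole x g t

/-- The clause `halt` makes `x` realize `X(0)`, since only the value `0` denotes the class of `0`.
The clause `call` makes `g` realize the successor step: a value denoting `s(d)` is some `k + 1`, and
injectivity of `s` modulo `E` shows that `k` denotes `d`. -/
theorem IsClassicalInteger.intPole {L : FirstOrder.Language.{u, v}}
    {zero : L.Functions 0} {succ : L.Functions 1} {E : Set (L.Term ℕ × L.Term ℕ)}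
    (hE : Adequate zero succ E) {n : ℕ} {θ : LamC} (hθ : IsClassicalInteger zero succ E n θ)
    (x g j : ℕ) :
    IntPole x g (appS (app (app θ.toCP (var x)) (var g)) (n, j)) := by
  let F : (Fin 1 → TermModel E) → Set (List (LamCP (ℕ × ℕ) ⊕ ℕ × ℕ)) := fun ds =>
    {π | ∃ p : ℕ × ℕ, π = [Sum.inr p] ∧ ds 0 = TermModel.mk E (numeral zero succ p.1)}
  let ρ : ℕ → TermModel E := fun _ => TermModel.mk E (zeroT zero)
  -- The type is closed and the context empty, so the valuation and the interpretation are
  -- arbitrary; `var` is taken as substitution because it acts as the identity.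
  have h := M2.realizes {t | IntPole x g t} (fun a b hab ρ => EqCons.realize_eq (E := E) hab ρ)
    (fun t t' => IntPole.step) hθ.2 ρ (fun _ _ _ _ => ∅) var (by simp)
  rw [subst_var] at h
  refine h [Sum.inl (var x), Sum.inl (var g), Sum.inr (n, j)]
    ⟨F, _, _, rfl, ?_, _, _, rfl, ?_, (n, j), rfl, realize_numeral zero succ n ρ⟩
  · rintro _ ⟨⟨k, i⟩, rfl, hp⟩
    have hp' : EqCons E (numeral zero succ 0) (numeral zero succ k) :=
      TermModel.mk_eq_mk.1 ((realize_numeral zero succ 0 ρ).symm.trans hp)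
    cases k with
    | zero => exact IntPole.halt i
    | succ k => exact absurd hp'.symm (hE.1 _)
  · rintro _ ⟨d, t, _, rfl, ht, ⟨k, i⟩, rfl, hp⟩
    have hp' : EqCons E (succT succ d.rep) (numeral zero succ k) := TermModel.mk_eq_mk.1 hp
    cases k with
    | zero => exact absurd hp' (hE.1 _)
    | succ k =>
      refine IntPole.call t k i fun i' => ht [Sum.inr (k, i')] ⟨(k, i'), rfl, ?_⟩
      exact (TermModel.mk_rep d).symm.trans (TermModel.mk_eq_mk.2 (hE.2 _ _ hp'))

/-- The run of a process of the pole, when every call of `g` is answered by a new stack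
constant: `s j` is the state after `j` answers, and `q j` is the stack constant allocated
by the answer number `j`. -/
theorem IntPole.exists_run {x g : ℕ} {u : LamCP (ℕ × ℕ)} (hu : IntPole x g u) (i : ℕ)
    (q : ℕ → ℕ × ℕ) (hq : Set.InjOn q (Set.Iic i)) (hc : ConstsIn (q '' Set.Iic i) u) :
    ∃ m ≥ i, ∃ (q' : ℕ → ℕ × ℕ) (r : ℕ → ℕ) (s t : ℕ → LamCP (ℕ × ℕ)),
      (∀ j ≤ i, q' j = q j) ∧ Set.InjOn q' (Set.Iic m) ∧ s i = u ∧
      (∀ j, i ≤ j → j ≤ m → r j ≤ j) ∧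
      (∀ j, i ≤ j → j < m →
        Red (s j) (appS (app (var g) (t (j + 1))) (q' (r j))) ∧
        s (j + 1) = appS (t (j + 1)) (q' (j + 1)) ∧ (q' (j + 1)).1 + 1 = (q' (r j)).1) ∧
      Red (s m) (appS (var x) (q' (r m))) ∧ (q' (r m)).1 = 0 := by
  induction hu generalizing i q with
  | halt j =>
    -- `a` is the index at which the constant on the stack was allocated; it serves as the value of
    -- `r`.
    obtain ⟨-, a, ha, hqa⟩ := hc
    refine ⟨i, le_rfl, q, fun _ => a, fun _ => appS (var x) (0, j), fun _ => var x,
      fun _ _ => rfl, hq, rfl, ?_, fun j h h' => absurd h (by omega), ?_, ?_⟩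
    · intro j hj _
      exact le_trans ha hj
    · rw [hqa]; exact Relation.ReflTransGen.refl
    · rw [hqa]
  | call t k j h ih =>
    obtain ⟨⟨-, ht⟩, a, ha, hqa⟩ := hc
    have ha : a ≤ i := ha
    -- The value `k` is forced, but infinitely many names carry it and only finitely many constants
    -- are in use.
    obtain ⟨e, he⟩ : ∃ e, (k, e) ∉ q '' Set.Iic i := by
      have hfin : ((fun e => (k, e)) ⁻¹' (q '' Set.Iic i)).Finite :=
        ((Set.finite_Iic i).image q).preimage (Prod.mk_right_injective k).injOn
      obtain ⟨e, he⟩ := hfin.exists_notMem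
      exact ⟨e, he⟩
    have hupd : ∀ j ≤ i, Function.update q (i + 1) (k, e) j = q j := fun j hj =>
      Function.update_of_ne (by omega) _ _
    have himg : q '' Set.Iic i ⊆ Function.update q (i + 1) (k, e) '' Set.Iic (i + 1) := by
      rintro _ ⟨b, hb, rfl⟩
      exact ⟨b, le_trans hb (Nat.le_succ i), hupd b hb⟩
    obtain ⟨m, hm, q', r, s, t', hq', hinj, hs, hr, hrun, hend, hval⟩ :=
      ih e (i + 1) (Function.update q (i + 1) (k, e))
        (by
          intro b hb c hc hbc
          have hb : b ≤ i + 1 := hb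
          have hc : c ≤ i + 1 := hc
          rcases hb.eq_or_lt with rfl | hb <;> rcases hc.eq_or_lt with rfl | hc
          · rfl
          · rw [Function.update_self, hupd c (by omega)] at hbc
            exact absurd ⟨c, Nat.lt_succ_iff.1 hc, hbc.symm⟩ he
          · rw [Function.update_self, hupd b (by omega)] at hbc
            exact absurd ⟨b, Nat.lt_succ_iff.1 hb, hbc⟩ he
          · rw [hupd b (by omega), hupd c (by omega)] at hbc
            exact hq (Nat.lt_succ_iff.1 hb) (Nat.lt_succ_iff.1 hc) hbc)
        ⟨ht.mono himg, i + 1, Set.self_mem_Iic, Function.update_self _ _ _⟩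
    have hq'' : ∀ j ≤ i, q' j = q j := fun j hj => (hq' j (by omega)).trans (hupd j hj)
    have hnew : q' (i + 1) = (k, e) := (hq' _ le_rfl).trans (Function.update_self _ _ _)
    -- The run from stage `i + 1` is extended backwards by the present call: `t`, the argument of
    -- `g` at stage `i`, gets the index `i + 1` because it is the head of the next state.
    refine ⟨m, by omega, q', Function.update r i a,
      Function.update s i (appS (app (var g) t) (k + 1, j)), Function.update t' (i + 1) t,
      hq'', hinj, Function.update_self _ _ _, ?_, ?_, ?_, ?_⟩
    · intro b hb hbm
      rcases hb.eq_or_lt with rfl | hb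
      · rwa [Function.update_self]
      · rw [Function.update_of_ne (by omega)]
        exact hr b hb hbm
    · intro b hb hbm
      rcases hb.eq_or_lt with rfl | hb
      · simp only [Function.update_self]
        rw [Function.update_of_ne (by omega), hq'' a ha, hqa, hs, hnew]
        exact ⟨Relation.ReflTransGen.refl, rfl, rfl⟩
      · simp only [Function.update_of_ne (show b ≠ i by omega),
          Function.update_of_ne (show b + 1 ≠ i by omega),
          Function.update_of_ne (show b + 1 ≠ i + 1 by omega)]
        exact hrun b hb hbm
    · rwa [Function.update_of_ne (by omega), Function.update_of_ne (by omega)]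
    · rwa [Function.update_of_ne (by omega)]
  | @step u u' h _ ih =>
    obtain ⟨m, hm, q', r, s, t, hq', hinj, hs, hr, hrun, hend, hval⟩ := ih i q hq (hc.step h)
    -- A head step answers no call: the stage stays `i`, and only the starting point of its
    -- reduction moves back.
    have hred : ∀ j v, Red (s j) v → Red (Function.update s i u j) v := by
      intro j v hv
      rcases eq_or_ne j i with rfl | hj
      · rw [Function.update_self]
        exact Relation.ReflTransGen.head h (hs ▸ hv)
      · rwa [Function.update_of_ne hj]
    refine ⟨m, hm, q', r, Function.update s i u, t, hq', hinj, Function.update_self _ _ _, hr,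
      ?_, hred _ _ hend, hval⟩
    intro j hj hjm
    obtain ⟨h1, h2, h3⟩ := hrun j hj hjm
    refine ⟨hred _ _ h1, ?_, h3⟩
    rwa [Function.update_of_ne (by omega)]

end Integers

end MixedLogic

/-! ### Transfer of the run to arbitrary stack constants. -/

theorem theorem5p6 {L : FirstOrder.Language.{u, v}}
    (zero : L.Functions 0) (succ : L.Functions 1)
    (E : Set (L.Term ℕ × L.Term ℕ)) (hE : MixedLogic.Adequate zero succ E)
    {P : Type w} [Infinite P]
    (n : ℕ) (θ : MixedLogic.LamC) (hθ : MixedLogic.IsClassicalInteger zero succ E n θ)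
    (x g : ℕ) (hxg : x ≠ g) :
    (n = 0 → ∀ p : P,
      MixedLogic.LamCP.Red
        (.appS (.app (.app θ.toCP (.var x)) (.var g)) p)
        (.appS (.var x) p)) ∧
    (n ≠ 0 → ∃ m : ℕ, 1 ≤ m ∧ ∃ (I : Fin (m + 1) → ℕ) (r : Fin (m + 1) → Fin (m + 1)),
      I 0 = n ∧ I (r (Fin.last m)) = 0 ∧
      (∀ i : Fin m, (I i.succ : ℤ) = (I (r i.castSucc) : ℤ) - 1) ∧
      ∀ p : Fin (m + 1) → P, Function.Injective p →
        -- only the values `t 1, …, t m` of `t` matter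
        ∃ t : ℕ → MixedLogic.LamCP P,
          MixedLogic.LamCP.Red
            (.appS (.app (.app θ.toCP (.var x)) (.var g)) (p 0))
            (.appS (.app (.var g) (t 1)) (p (r 0))) ∧
          (∀ i : Fin (m + 1), 1 ≤ (i : ℕ) → (i : ℕ) < m →
            MixedLogic.LamCP.Red
              (.appS (t i) (p i))
              (.appS (.app (.var g) (t (i + 1))) (p (r i)))) ∧
          MixedLogic.LamCP.Red
            (.appS (t m) (p (Fin.last m)))
            (.appS (.var x) (p (r (Fin.last m))))) := by
  obtain ⟨m, -, q, r, s, t, hq, hinj, hs, hr, hrun, hend, hval⟩ :=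
    (hθ.intPole hE x g 0).exists_run 0 (fun _ => (n, 0))
      (by
        intro a ha b hb _
        rw [Nat.le_zero.1 ha, Nat.le_zero.1 hb])
      ⟨⟨⟨MixedLogic.LamCP.constsIn_toCP θ, trivial⟩, trivial⟩, 0, Set.self_mem_Iic, rfl⟩
  have hq0 : q 0 = (n, 0) := hq 0 le_rfl
  have hr0 : r 0 = 0 := Nat.le_zero.1 (hr 0 le_rfl (Nat.zero_le m))
  constructor
  · rintro rfl p
    -- A call at stage `0` could only involve `q 0`, whose value `0` is not a successor.
    obtain rfl : m = 0 := by
      by_contra hm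
      have h := (hrun 0 le_rfl (Nat.pos_of_ne_zero hm)).2.2
      rw [hr0, hq0] at h
      exact Nat.succ_ne_zero _ h
    rw [hs] at hend
    have h := hend.mapConst fun _ => p
    simpa only [MixedLogic.LamCP.mapConst, MixedLogic.LamCP.mapConst_toCP] using h
  · intro hn
    have hm : 1 ≤ m := by
      rw [Nat.one_le_iff_ne_zero]
      rintro rfl
      rw [hr0, hq0] at hval
      exact hn hval
    refine ⟨m, hm, fun i => (q i).1,
      fun i => ⟨r i, ((hr i (Nat.zero_le _) i.is_le).trans i.is_le).trans_lt (Nat.lt_succ_self m)⟩,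
      by simp [hq0], hval, ?_, ?_⟩
    · intro i
      have h := (hrun i (Nat.zero_le _) i.is_lt).2.2
      simp only [Fin.val_succ, Fin.val_castSucc]
      omega
    · intro p _
      have hinj' : Function.Injective fun i : Fin (m + 1) => q i := fun a b hab =>
        Fin.ext (hinj a.is_le b.is_le hab)
      -- Distinctness of the allocated constants is what lets one renaming send each `q i` to the
      -- prescribed `p i`.
      obtain ⟨f, hf⟩ : ∃ f : ℕ × ℕ → P, ∀ i : Fin (m + 1), f (q i) = p i :=
        ⟨Function.extend (fun i : Fin (m + 1) => q i) p fun _ => p 0, hinj'.extend_apply _ _⟩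
      -- Stage `0` is excluded: there the state is the initial process, and `t 0` has no meaning.
      have hstate : ∀ i, 1 ≤ i → i ≤ m → s i = .appS (t i) (q i) := by
        intro i hi him
        obtain ⟨j, rfl⟩ := Nat.exists_eq_add_of_le' hi
        exact (hrun j (Nat.zero_le _) him).2.1
      have hfr : ∀ i : Fin (m + 1), f (q (r i)) =
          p ⟨r i, ((hr i (Nat.zero_le _) i.is_le).trans i.is_le).trans_lt
            (Nat.lt_succ_self m)⟩ := fun i => hf ⟨r i, _⟩
      refine ⟨fun i => (t i).mapConst f, ?_, ?_, ?_⟩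
      · have h := (hrun 0 le_rfl hm).1.mapConst f
        rw [hs] at h
        simp only [MixedLogic.LamCP.mapConst, MixedLogic.LamCP.mapConst_toCP] at h
        rw [← hfr 0, ← hf 0, Fin.val_zero, hq0]
        exact h
      · intro i hi him
        have h := (hrun i (Nat.zero_le _) him).1.mapConst f
        rw [hstate i hi him.le] at h
        rw [← hfr i, ← hf i]
        exact h
      · have h := hend.mapConst f
        rw [hstate m hm le_rfl] at h
        rw [← hfr (Fin.last m), ← hf (Fin.last m)]
        exact h
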